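/- A vincular pattern of length $k$ is a pair $(\sigma, X)$ of a permutation $\sigma\in S_k$ and a set $X\subseteq\{1,\dots,k-1\}$; it is written as the word $\sigma_1\cdots\sigma_k$ with a dash between $\sigma_j$ and $\sigma_{j+1}$ exactly when $j\notin X$. A permutation $\pi\in S_n$ contains $(\sigma,X)$ if there are indices $1\le i_1<\dots<i_k\le n$ such that $\pi_{i_1}\cdots\pi_{i_k}$ is order-isomorphic to $\sigma$ and $i_{j+1}=i_j+1$ for every $j\in X$; otherwise $\pi$ avoids $(\sigma,X)$. Two vincular patterns are Wilf-equivalent, written $\sim$, if for every $n\ge 0$ the same number of permutations in $S_n$ avoid the one as avoid the other. Then the following Wilf-equivalences hold: $$3\text{-}12\text{-}4 \;\sim\; 1\text{-}23\text{-}4 \;\sim\; 1\text{-}32\text{-}4 \;\sim\; 3\text{-}21\text{-}4.$$ -/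

import Mathlib

/-- A vincular pattern `(σ, X)` of length `k`: a permutation `σ` of `k` letters (positions and
values are counted from `0` in `Fin k`) and a set of adjacencies `X ⊆ [k - 1] = {1, …, k - 1}`,
counted from `1` as on paper: `j ∈ X` says that there is no dash between the `j`-th and the
`(j + 1)`-st letter. -/
structure VincularPattern (k : ℕ) where
  perm : Equiv.Perm (Fin k)
  adj : Finset ℕ
  adj_subset : adj ⊆ Finset.Icc 1 (k - 1)

namespace VincularPattern

/-- The subsequence of `π` at the positions `i 0 < i 1 < ⋯ < i (k - 1)` is a copy of the pattern:
it is order-isomorphic to `σ`, and for each `j ∈ X` the position of its `(j + 1)`-st letter is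
the position of its `j`-th letter plus one. -/
def IsCopy {k n : ℕ} (p : VincularPattern k) (π : Equiv.Perm (Fin n)) (i : Fin k ↪o Fin n) : Prop :=
  (∀ a b : Fin k, π (i a) ≤ π (i b) ↔ p.perm a ≤ p.perm b) ∧
    ∀ a b : Fin k, (b : ℕ) = (a : ℕ) + 1 → (a : ℕ) + 1 ∈ p.adj → (i b : ℕ) = (i a : ℕ) + 1

/-- `π` contains the pattern. -/
def ContainedIn {k n : ℕ} (p : VincularPattern k) (π : Equiv.Perm (Fin n)) : Prop :=
  ∃ i : Fin k ↪o Fin n, p.IsCopy π i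

/-- The set of permutations of length `n` that avoid the pattern. -/
def avoiders {k : ℕ} (p : VincularPattern k) (n : ℕ) : Set (Equiv.Perm (Fin n)) :=
  {π | ¬ p.ContainedIn π}

/-- Wilf-equivalence: equally many permutations of each length `n ≥ 0` avoid either pattern. -/
def WilfEquiv {k l : ℕ} (p : VincularPattern k) (q : VincularPattern l) : Prop :=
  ∀ n : ℕ, (p.avoiders n).ncard = (q.avoiders n).ncard

/-- The vincular pattern 3-12-4. -/
def p3_12_4 : VincularPattern 4 where
  perm := ⟨![2, 0, 1, 3], ![1, 2, 0, 3], by decide, by decide⟩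
  adj := {2}
  adj_subset := by decide

/-- The vincular pattern 1-23-4. -/
def p1_23_4 : VincularPattern 4 where
  perm := ⟨![0, 1, 2, 3], ![0, 1, 2, 3], by decide, by decide⟩
  adj := {2}
  adj_subset := by decide

/-- The vincular pattern 1-32-4. -/
def p1_32_4 : VincularPattern 4 where
  perm := ⟨![0, 2, 1, 3], ![0, 2, 1, 3], by decide, by decide⟩
  adj := {2}
  adj_subset := by decide

/-- The vincular pattern 3-21-4. -/
def p3_21_4 : VincularPattern 4 where
  perm := ⟨![2, 1, 0, 3], ![2, 1, 0, 3], by decide, by decide⟩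
  adj := {2}
  adj_subset := by decide

end VincularPattern

/-!
Read a permutation `π` of `Fin n` from right to left, recording at each position `j` its *code*,
the rank of `π j` among the values `π 0, …, π j` that are still to be placed. The codes are
exactly the functions with `code j ≤ j` (`code_injective` and a count, `exists_code_eq`).

In each of the four patterns the final letter `4` only says that the other letters lie under some
later, larger value. This is governed by `free π j`, the number of values among `π 0, …, π j` lying
below the largest value to the right of `j`: the position `j` is no right-to-left maximum exactly
when `code π j < free π j`. Going one step to the left, `free` drops by one at such a position, and
is reset to the code at a right-to-left maximum (`free_succ_of_lt`, `free_of_le`). So `free` is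
determined by the code, and it does not change if the codes below it are permuted among themselves.

Write `f = free π (j + 1)`, `x = code π (j + 1)` and `y = code π j`, where neither `j` nor `j + 1`
is a right-to-left maximum, so that `x < f` and `y < f - 1`; the two adjacent letters of a copy
always stand at such positions. A copy with these letters at `j` and `j + 1` exists precisely if

* `1-23-4`: `y < x` and `y ≠ 0`;
* `1-32-4`: `x ≤ y` and `x ≠ 0`;
* `3-21-4`: `x ≤ y` and `y + 2 < f`;
* `3-12-4`: `y < x` and `x + 1 < f`.

The involution `c ↦ f - 1 - c` of `{0, …, f - 1}`, applied at each position with its own `f`,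
exchanges the first condition with the third and the second with the fourth; the involution fixing
`0` and sending `c ≠ 0` to `f - c` exchanges the first with the second. Each of them therefore
induces an involution of the permutations (`ncard_avoiders_eq`) which proves an equivalence.
-/

open Finset

namespace VincularPattern

variable {n : ℕ}

/-! ### The code of a permutation -/

/-- The rank (counted from `0`) of `π j` among the values `π 0, …, π j`. -/
def code (π : Equiv.Perm (Fin n)) (j : Fin n) : ℕ :=
  #{i | i < j ∧ π i < π j}

/-- The number of positions `i ≤ j` whose value is below the largest value to the right of `j`. -/
def free (π : Equiv.Perm (Fin n)) (j : Fin n) : ℕ :=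
  #{i | i ≤ j ∧ ∃ k, j < k ∧ π i < π k}

theorem code_le (π : Equiv.Perm (Fin n)) (j : Fin n) : code π j ≤ j := by
  calc code π j ≤ #(Finset.Iio j) := card_le_card fun i hi => by simp_all
    _ = j := Fin.card_Iio j

theorem free_le (π : Equiv.Perm (Fin n)) (j : Fin n) : free π j ≤ j + 1 := by
  calc free π j ≤ #(Finset.Iic j) := card_le_card fun i hi => by simp_all
    _ = j + 1 := Fin.card_Iic j

theorem code_injective : Function.Injective (code : Equiv.Perm (Fin n) → Fin n → ℕ) := by
  intro π σ h
  -- Two permutations that agree to the right of `j` have the same values left to place.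
  have key : ∀ (π σ : Equiv.Perm (Fin n)) (j : Fin n), (∀ i, j < i → π i = σ i) →
      π j < σ j → code π j < code σ j := by
    intro π σ j hj hlt
    have hmem : ∀ i, i ≤ j → σ.symm (π i) ≤ j := by
      intro i hi
      by_contra! hcon
      have := hj _ hcon
      rw [Equiv.apply_symm_apply] at this
      exact absurd (π.injective this ▸ hcon) (not_lt.2 hi)
    have hcard : code π j + 1 = #{i | i ≤ j ∧ π i ≤ π j} := by
      rw [code, ← card_insert_of_notMem (a := j) (by simp)]
      congr 1
      ext i
      have := π.injective.eq_iff (a := i) (b := j)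
      simp only [mem_insert, mem_filter, mem_univ, true_and]
      grind
    have hle : #{i | i ≤ j ∧ π i ≤ π j} ≤ code σ j := by
      refine card_le_card_of_injOn (fun i => σ.symm (π i)) ?_ ?_
      · intro i hi
        simp only [coe_filter, Set.mem_ofPred_eq, mem_univ, true_and] at hi ⊢
        have hlt' : π i < σ j := hi.2.trans_lt hlt
        refine ⟨lt_of_le_of_ne (hmem i hi.1) fun he => ?_, by simpa using hlt'⟩
        rw [Equiv.symm_apply_eq] at he
        exact hlt'.ne he
      · exact fun a _ b _ hab => π.injective (σ.symm.injective hab)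
    omega
  have step : ∀ m : ℕ, ∀ j : Fin n, n - j ≤ m → π j = σ j := by
    intro m
    induction m with
    | zero => intro j hj; omega
    | succ m ih =>
      intro j hj
      have hright : ∀ i, j < i → π i = σ i := fun i hi => ih i (by omega)
      have hc := congrFun h j
      rcases lt_trichotomy (π j) (σ j) with hlt | heq | hgt
      · exact absurd hc (key π σ j hright hlt).ne
      · exact heq
      · exact absurd hc (key σ π j (fun i hi => (hright i hi).symm) hgt).ne'
  exact Equiv.ext fun j => step _ j le_rfl

/-- Every function with `c j ≤ j` is a code, as there are `n!` of them. -/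
theorem exists_code_eq (c : Fin n → ℕ) (hc : ∀ j, c j ≤ j) :
    ∃ π : Equiv.Perm (Fin n), code π = c := by
  let F : Equiv.Perm (Fin n) → (j : Fin n) → Fin ((j : ℕ) + 1) :=
    fun π j => ⟨code π j, Nat.lt_succ_of_le (code_le π j)⟩
  have hF : Function.Bijective F := by
    refine (Fintype.bijective_iff_injective_and_card F).2 ⟨fun π σ h => ?_, ?_⟩
    · exact code_injective (funext fun j => congrArg Fin.val (congrFun h j))
    · rw [Fintype.card_perm, Fintype.card_pi]
      simp only [Fintype.card_fin]
      rw [Fin.prod_univ_eq_prod_range (fun j => j + 1) n, prod_range_add_one_eq_factorial]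
  obtain ⟨π, hπ⟩ := hF.2 fun j => ⟨c j, Nat.lt_succ_of_le (hc j)⟩
  exact ⟨π, funext fun j => congrArg Fin.val (congrFun hπ j)⟩

theorem code_ne_zero_iff (π : Equiv.Perm (Fin n)) (j : Fin n) :
    code π j ≠ 0 ↔ ∃ i, i < j ∧ π i < π j := by
  simp [code, filter_eq_empty_iff]

theorem code_lt_code_iff (π : Equiv.Perm (Fin n)) {j j' : Fin n} (hj : (j : ℕ) + 1 = j') :
    code π j < code π j' ↔ π j < π j' := by
  constructor
  · intro h
    by_contra! hcon
    refine absurd h (not_lt.2 (card_le_card fun i => ?_))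
    simp only [mem_filter, mem_univ, true_and]
    rintro ⟨h1, h2⟩
    have hne : i ≠ j := fun he => absurd h2 (not_lt.2 (he ▸ hcon))
    exact ⟨by omega, h2.trans_le hcon⟩
  · intro h
    refine card_lt_card (ssubset_iff_of_subset ?_ |>.2 ⟨j, ?_, ?_⟩)
    · intro i
      simp only [mem_filter, mem_univ, true_and]
      exact fun hi => ⟨by omega, hi.2.trans h⟩
    · simp only [mem_filter, mem_univ, true_and]
      exact ⟨by omega, h⟩
    · simp

/-! ### The number of free values below the running maximum -/

theorem code_lt_free_iff (π : Equiv.Perm (Fin n)) (j : Fin n) :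
    code π j < free π j ↔ ∃ k, j < k ∧ π j < π k := by
  constructor
  · intro h
    by_contra! hcon
    refine absurd h (not_lt.2 (card_le_card fun i => ?_))
    simp only [mem_filter, mem_univ, true_and]
    rintro ⟨h1, k, hk, h2⟩
    have h3 := h2.trans_le (hcon k hk)
    exact ⟨lt_of_le_of_ne h1 fun he => h3.ne (congrArg π he), h3⟩
  · rintro ⟨k, hk, h⟩
    refine card_lt_card (ssubset_iff_of_subset ?_ |>.2 ⟨j, ?_, ?_⟩)
    · intro i
      simp only [mem_filter, mem_univ, true_and]
      exact fun hi => ⟨hi.1.le, k, hk, hi.2.trans h⟩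
    · simp only [mem_filter, mem_univ, true_and]
      exact ⟨le_rfl, k, hk, h⟩
    · simp

theorem code_add_one_lt_free_iff (π : Equiv.Perm (Fin n)) (j : Fin n) :
    code π j + 1 < free π j ↔ ∃ i, i < j ∧ π j < π i ∧ ∃ k, j < k ∧ π i < π k := by
  have hcard : code π j + 1 = #(insert j (univ.filter fun i => i < j ∧ π i < π j)) := by
    rw [card_insert_of_notMem (by simp), code]
  rw [hcard]
  constructor
  · intro h
    by_contra! hcon
    refine absurd h (not_lt.2 (card_le_card fun i => ?_))
    simp only [mem_filter, mem_univ, true_and, mem_insert]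
    rintro ⟨h1, k, hk, h2⟩
    rcases h1.eq_or_lt with h1 | h1
    · exact Or.inl h1
    · refine Or.inr ⟨h1, ?_⟩
      by_contra! h3
      have h4 : π j ≠ π i := fun he => h1.ne' (π.injective he)
      exact absurd h2 (not_lt.2 (hcon i h1 (lt_of_le_of_ne h3 h4) k hk))
  · rintro ⟨i, hi, hji, k, hk, h⟩
    refine card_lt_card (ssubset_iff_of_subset ?_ |>.2 ⟨i, ?_, ?_⟩)
    · intro a
      simp only [mem_filter, mem_univ, true_and, mem_insert]
      rintro (rfl | ha)
      · exact ⟨le_rfl, k, hk, hji.trans h⟩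
      · exact ⟨ha.1.le, k, hk, ha.2.trans (hji.trans h)⟩
    · simp only [mem_filter, mem_univ, true_and]
      exact ⟨hi.le, k, hk, h⟩
    · simp [hi.ne, hji.le]

theorem free_last (π : Equiv.Perm (Fin n)) {j : Fin n} (hj : (j : ℕ) + 1 = n) :
    free π j = 0 := by
  simp only [free, card_eq_zero, filter_eq_empty_iff, mem_univ, true_imp_iff]
  rintro i ⟨-, k, hk, -⟩
  omega

theorem free_succ_of_lt (π : Equiv.Perm (Fin n)) {j j' : Fin n} (hj : (j : ℕ) + 1 = j')
    (h : code π j' < free π j') : free π j + 1 = free π j' := by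
  obtain ⟨k, hk, hjk⟩ := (code_lt_free_iff π j').1 h
  have hnot : j' ∉ (univ.filter fun i => i ≤ j ∧ ∃ k, j < k ∧ π i < π k) := by
    simp only [mem_filter, mem_univ, true_and]
    intro h
    omega
  rw [free, ← card_insert_of_notMem hnot, free]
  congr 1
  ext i
  simp only [mem_filter, mem_univ, true_and, mem_insert]
  constructor
  · rintro (rfl | ⟨h1, l, hl, h2⟩)
    · exact ⟨le_rfl, k, hk, hjk⟩
    · refine ⟨by omega, ?_⟩
      by_cases hlj : l = j'
      · exact ⟨k, hk, (hlj ▸ h2).trans hjk⟩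
      · exact ⟨l, by omega, h2⟩
  · rintro ⟨h1, l, hl, h2⟩
    by_cases hij : i = j'
    · exact Or.inl hij
    · exact Or.inr ⟨by omega, l, by omega, h2⟩

theorem free_of_le (π : Equiv.Perm (Fin n)) {j j' : Fin n} (hj : (j : ℕ) + 1 = j')
    (h : free π j' ≤ code π j') : free π j = code π j' := by
  have hmax := (code_lt_free_iff π j').not.1 (not_lt.2 h)
  push Not at hmax
  rw [free, code]
  congr 1
  ext i
  simp only [mem_filter, mem_univ, true_and]
  constructor
  · rintro ⟨h1, l, hl, h2⟩
    refine ⟨by omega, ?_⟩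
    by_cases hlj : l = j'
    · exact hlj ▸ h2
    · exact h2.trans_le (hmax l (by omega))
  · rintro ⟨h1, h2⟩
    exact ⟨by omega, j', by omega, h2⟩

/-! ### Recoding by an involution -/

/-- The function `free` depends on the code through the values below `free` only by their number,
so a recoding that acts within these values leaves it unchanged. -/
theorem free_eq_of_code_eq {g : ℕ → ℕ → ℕ} (hlt : ∀ f c, c < f → g f c < f)
    (hle : ∀ f c, f ≤ c → g f c = c) {π σ : Equiv.Perm (Fin n)}
    (h : ∀ j, code σ j = g (free π j) (code π j)) : free σ = free π := by
  have step : ∀ m : ℕ, ∀ j : Fin n, n - j ≤ m → free σ j = free π j := by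
    intro m
    induction m with
    | zero => intro j hj; omega
    | succ m ih =>
      intro j hj
      by_cases hlast : (j : ℕ) + 1 = n
      · rw [free_last σ hlast, free_last π hlast]
      · have hj' : (j : ℕ) + 1 = (⟨j + 1, by omega⟩ : Fin n) := rfl
        generalize (⟨j + 1, by omega⟩ : Fin n) = j' at hj'
        have ih' := ih j' (by omega)
        have hc := h j'
        rcases lt_or_ge (code π j') (free π j') with hcase | hcase
        · have h1 := free_succ_of_lt π hj' hcase
          have h2 := free_succ_of_lt σ hj' (by rw [hc, ih']; exact hlt _ _ hcase)
          omega
        · rw [hle _ _ hcase] at hc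
          rw [free_of_le π hj' hcase, free_of_le σ hj' (by rw [hc, ih']; exact hcase), hc]
  exact funext fun j => step _ j le_rfl

/-- Every adjacent pair of positions that are no right-to-left maxima satisfies the condition `P`
on `free` at the right one, the code at the right one, and the code at the left one. -/
def LocallyGood (P : ℕ → ℕ → ℕ → Prop) (π : Equiv.Perm (Fin n)) : Prop :=
  ∀ j j' : Fin n, (j : ℕ) + 1 = j' → code π j' < free π j' → code π j < free π j →
    P (free π j') (code π j') (code π j)

/-- A family `g f` of involutions of `{0, …, f - 1}` that translates the local condition `P` into
`Q` gives an involution of the permutations that takes those good for `P` to those good for `Q`. -/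
theorem ncard_avoiders_eq {k l : ℕ} {p : VincularPattern k} {q : VincularPattern l}
    {P Q : ℕ → ℕ → ℕ → Prop}
    (hp : ∀ π : Equiv.Perm (Fin n), ¬ p.ContainedIn π ↔ LocallyGood P π)
    (hq : ∀ π : Equiv.Perm (Fin n), ¬ q.ContainedIn π ↔ LocallyGood Q π)
    {g : ℕ → ℕ → ℕ} (hlt : ∀ f c, c < f → g f c < f) (hle : ∀ f c, f ≤ c → g f c = c)
    (hinv : ∀ f c, g f (g f c) = c)
    (hPQ : ∀ f x y, x < f → y + 1 < f → (P f x y ↔ Q f (g f x) (g (f - 1) y))) :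
    (p.avoiders n).ncard = (q.avoiders n).ncard := by
  have hex : ∀ π : Equiv.Perm (Fin n), ∃ σ : Equiv.Perm (Fin n),
      code σ = fun j => g (free π j) (code π j) := by
    refine fun π => exists_code_eq _ fun j => ?_
    rcases lt_or_ge (code π j) (free π j) with h | h
    · have := hlt _ _ h
      have := free_le π j
      omega
    · rw [hle _ _ h]
      exact code_le π j
  choose φ hφ using hex
  have hcode : ∀ π j, code (φ π) j = g (free π j) (code π j) := fun π j => congrFun (hφ π) j
  have hfree : ∀ π, free (φ π) = free π := fun π => free_eq_of_code_eq hlt hle (hcode π)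
  have hφφ : Function.Involutive φ := fun π => code_injective <| funext fun j => by
    rw [hcode, hcode, hfree, hinv]
  have hiff : ∀ f c, g f c < f ↔ c < f := fun f c =>
    ⟨fun h => by simpa [hinv] using hlt _ _ h, hlt f c⟩
  have hgood : ∀ π, LocallyGood Q (φ π) ↔ LocallyGood P π := by
    intro π
    refine forall₃_congr fun j j' hj => ?_
    rw [hfree, hcode, hcode, hiff, hiff]
    refine forall₂_congr fun h h' => ?_
    have hs := free_succ_of_lt π hj h
    rw [hPQ _ _ _ h (by omega), ← hs, Nat.add_sub_cancel]
  have himage : q.avoiders n = φ '' p.avoiders n := by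
    rw [hφφ.image_eq_preimage_symm]
    ext π
    simp only [avoiders, Set.mem_ofPred_eq, Set.mem_preimage, hp, hq]
    rw [← hgood, hφφ]
  rw [himage, Set.ncard_image_of_injective _ hφφ.injective]

/-! ### Copies of the four patterns -/

theorem containedIn_iff_of_adj_eq {p : VincularPattern 4} (hp : p.adj = {2})
    (π : Equiv.Perm (Fin n)) :
    p.ContainedIn π ↔ ∃ i j j' k : Fin n, (i < j ∧ (j : ℕ) + 1 = j' ∧ j' < k) ∧
      ∀ a b, π (![i, j, j', k] a) ≤ π (![i, j, j', k] b) ↔ p.perm a ≤ p.perm b := by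
  constructor
  · rintro ⟨e, he, hadj⟩
    refine ⟨e 0, e 1, e 2, e 3, ⟨by simp, ?_, by simp⟩, ?_⟩
    · exact (hadj 1 2 rfl (by simp [hp])).symm
    · have : ![e 0, e 1, e 2, e 3] = e := by
        ext a; fin_cases a <;> rfl
      rw [this]
      exact he
  · rintro ⟨i, j, j', k, ⟨hij, hj, hk⟩, h⟩
    have hmono : StrictMono ![i, j, j', k] := by
      refine Fin.strictMono_iff_lt_succ.2 fun a => ?_
      fin_cases a
      · exact hij
      · exact Fin.lt_def.2 (by simp; omega)
      · exact hk
    refine ⟨OrderEmbedding.ofStrictMono _ hmono, h, fun a b hab ha => ?_⟩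
    rw [hp, Finset.mem_singleton] at ha
    obtain rfl : a = 1 := by ext; simp; omega
    obtain rfl : b = 2 := by ext; simpa using hab
    exact hj.symm

theorem avoids_1_23_4_iff (π : Equiv.Perm (Fin n)) :
    ¬ p1_23_4.ContainedIn π ↔ LocallyGood (fun _ x y => ¬(y < x ∧ y ≠ 0)) π := by
  rw [containedIn_iff_of_adj_eq rfl]
  simp only [LocallyGood]
  rw [not_iff_comm]
  push Not
  constructor
  · rintro ⟨j, j', hj, h', -, h1, h2⟩
    obtain ⟨i, hi, h2⟩ := (code_ne_zero_iff π j).1 h2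
    obtain ⟨k, hk, h3⟩ := (code_lt_free_iff π j').1 h'
    rw [code_lt_code_iff π hj] at h1
    refine ⟨i, j, j', k, ⟨hi, hj, hk⟩, ?_⟩
    simp [Fin.forall_fin_succ, p1_23_4]
    omega
  · rintro ⟨i, j, j', k, ⟨hi, hj, hk⟩, h⟩
    simp [Fin.forall_fin_succ, p1_23_4] at h
    have h1 : π j < π j' := by omega
    exact ⟨j, j', hj, (code_lt_free_iff π j').2 ⟨k, hk, by omega⟩,
      (code_lt_free_iff π j).2 ⟨k, by omega, by omega⟩, (code_lt_code_iff π hj).2 h1,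
      (code_ne_zero_iff π j).2 ⟨i, hi, by omega⟩⟩

theorem avoids_1_32_4_iff (π : Equiv.Perm (Fin n)) :
    ¬ p1_32_4.ContainedIn π ↔ LocallyGood (fun _ x y => ¬(x ≤ y ∧ x ≠ 0)) π := by
  rw [containedIn_iff_of_adj_eq rfl]
  simp only [LocallyGood]
  rw [not_iff_comm]
  push Not
  constructor
  · rintro ⟨j, j', hj, -, h', h1, h2⟩
    obtain ⟨i, hi, h2⟩ := (code_ne_zero_iff π j').1 h2
    obtain ⟨k, hk, h3⟩ := (code_lt_free_iff π j).1 h'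
    rw [← not_lt, code_lt_code_iff π hj, not_lt] at h1
    -- The smaller letter before `j'` is not at `j`, and the larger one after `j` is not at `j'`.
    have hij : i ≠ j := fun he => absurd h2 (not_lt.2 (he ▸ h1))
    have hkj : k ≠ j' := fun he => absurd h3 (not_lt.2 (he ▸ h1))
    have hjj : π j' ≠ π j := fun he => by have := π.injective he; omega
    refine ⟨i, j, j', k, ⟨by omega, hj, by omega⟩, ?_⟩
    simp [Fin.forall_fin_succ, p1_32_4]
    omega
  · rintro ⟨i, j, j', k, ⟨hi, hj, hk⟩, h⟩
    simp [Fin.forall_fin_succ, p1_32_4] at h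
    refine ⟨j, j', hj, (code_lt_free_iff π j').2 ⟨k, hk, by omega⟩,
      (code_lt_free_iff π j).2 ⟨k, by omega, by omega⟩, ?_,
      (code_ne_zero_iff π j').2 ⟨i, by omega, by omega⟩⟩
    rw [← not_lt, code_lt_code_iff π hj]
    omega

theorem avoids_3_21_4_iff (π : Equiv.Perm (Fin n)) :
    ¬ p3_21_4.ContainedIn π ↔ LocallyGood (fun f x y => ¬(x ≤ y ∧ y + 2 < f)) π := by
  rw [containedIn_iff_of_adj_eq rfl]
  simp only [LocallyGood]
  rw [not_iff_comm]
  push Not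
  constructor
  · rintro ⟨j, j', hj, h', -, h1, h2⟩
    have hs := free_succ_of_lt π hj h'
    obtain ⟨i, hi, h2, k, hk, h3⟩ := (code_add_one_lt_free_iff π j).1 (by omega)
    rw [← not_lt, code_lt_code_iff π hj, not_lt] at h1
    have hkj : k ≠ j' := fun he => by rw [he] at h3; omega
    have hjj : π j' ≠ π j := fun he => by have := π.injective he; omega
    refine ⟨i, j, j', k, ⟨hi, hj, by omega⟩, ?_⟩
    simp [Fin.forall_fin_succ, p3_21_4]
    omega
  · rintro ⟨i, j, j', k, ⟨hi, hj, hk⟩, h⟩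
    simp [Fin.forall_fin_succ, p3_21_4] at h
    have h' := (code_lt_free_iff π j').2 ⟨k, hk, by omega⟩
    have hs := free_succ_of_lt π hj h'
    have h2 := (code_add_one_lt_free_iff π j).2 ⟨i, hi, by omega, k, by omega, by omega⟩
    refine ⟨j, j', hj, h', by omega, ?_, by omega⟩
    rw [← not_lt, code_lt_code_iff π hj]
    omega

theorem avoids_3_12_4_iff (π : Equiv.Perm (Fin n)) :
    ¬ p3_12_4.ContainedIn π ↔ LocallyGood (fun f x y => ¬(y < x ∧ x + 1 < f)) π := by
  rw [containedIn_iff_of_adj_eq rfl]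
  simp only [LocallyGood]
  rw [not_iff_comm]
  push Not
  constructor
  · rintro ⟨j, j', hj, -, -, h1, h2⟩
    obtain ⟨i, hi, h2, k, hk, h3⟩ := (code_add_one_lt_free_iff π j').1 h2
    rw [code_lt_code_iff π hj] at h1
    have hij : i ≠ j := fun he => by rw [he] at h2; omega
    refine ⟨i, j, j', k, ⟨by omega, hj, hk⟩, ?_⟩
    simp [Fin.forall_fin_succ, p3_12_4]
    omega
  · rintro ⟨i, j, j', k, ⟨hi, hj, hk⟩, h⟩
    simp [Fin.forall_fin_succ, p3_12_4] at h
    exact ⟨j, j', hj, (code_lt_free_iff π j').2 ⟨k, hk, by omega⟩,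
      (code_lt_free_iff π j).2 ⟨k, by omega, by omega⟩,
      (code_lt_code_iff π hj).2 (by omega),
      (code_add_one_lt_free_iff π j').2 ⟨i, by omega, by omega, k, hk, by omega⟩⟩

/-! ### The equivalences -/

/-- The order-reversing involution of `{0, …, f - 1}`, extended by the identity. -/
def reflect (f c : ℕ) : ℕ :=
  if c < f then f - 1 - c else c

/-- The involution of `{0, …, f - 1}` that fixes `0` and reverses the order of the other elements,
extended by the identity. -/
def reflectNeZero (f c : ℕ) : ℕ :=
  if c < f ∧ c ≠ 0 then f - c else c

theorem wilfEquiv_1_23_4_3_21_4 : WilfEquiv p1_23_4 p3_21_4 := by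
  refine fun n => ncard_avoiders_eq avoids_1_23_4_iff avoids_3_21_4_iff (g := reflect) ?_ ?_ ?_ ?_
  all_goals intros; grind [reflect]

theorem wilfEquiv_1_32_4_3_12_4 : WilfEquiv p1_32_4 p3_12_4 := by
  refine fun n => ncard_avoiders_eq avoids_1_32_4_iff avoids_3_12_4_iff (g := reflect) ?_ ?_ ?_ ?_
  all_goals intros; grind [reflect]

theorem wilfEquiv_1_23_4_1_32_4 : WilfEquiv p1_23_4 p1_32_4 := by
  refine fun n =>
    ncard_avoiders_eq avoids_1_23_4_iff avoids_1_32_4_iff (g := reflectNeZero) ?_ ?_ ?_ ?_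
  all_goals intros; grind [reflectNeZero]

end VincularPattern

open VincularPattern in
theorem mainTheorem5 :
    VincularPattern.WilfEquiv VincularPattern.p3_12_4 VincularPattern.p1_23_4 ∧
      VincularPattern.WilfEquiv VincularPattern.p1_23_4 VincularPattern.p1_32_4 ∧
      VincularPattern.WilfEquiv VincularPattern.p1_32_4 VincularPattern.p3_21_4 :=
  ⟨fun n => ((wilfEquiv_1_23_4_1_32_4 n).trans (wilfEquiv_1_32_4_3_12_4 n)).symm,
    wilfEquiv_1_23_4_1_32_4,
    fun n => (wilfEquiv_1_23_4_1_32_4 n).symm.trans (wilfEquiv_1_23_4_3_21_4 n)⟩
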